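/- \textbf{Setting.} Let $A\in\mathbb R^{n\times n}$, $B\in\mathbb R^{n\times l}$, $E\in\mathbb R^{n\times m}$, $z\in\mathbb R^n$ with $(A,B)$ stabilizable; let $Q_1,Q_2\in\mathbb R^{n\times n}$ and $R_2\in\mathbb R^{l\times l}$ be symmetric positive semidefinite, $R_1\in\mathbb R^{l\times l}$ symmetric positive definite, $s\in\mathbb R^n$, $v\in\mathbb R^l$, $c\in\mathbb R$. Let $(\Omega,\mathcal F,\mathbb P)$ be a probability space and $(W(k))_{k\in\mathbb N_0}$ an i.i.d. sequence in $L^2(\Omega;\mathbb R^m)$ with law $\varrho_W$ and mean $\mu_W$. Put $f(x,u,w)=Ax+Bu+Ew+z$ and, for $X\in L^2(\Omega;\mathbb R^n)$, $U\in L^2(\Omega;\mathbb R^l)$, $$\ell(X,U)=\mathbb E\big[X^TQ_1X+U^TR_1U+s^TX+v^TU+c\big]+\operatorname{Tr}\big(Q_2\operatorname{Cov}(X)\big)+\operatorname{Tr}\big(R_2\operatorname{Cov}(U)\big).$$ State and control processes $(X(\cdot),U(\cdot))$ are always square integrable, with $W(k)$ independent of $(X(k),U(k))$ and $X(k+1)=f(X(k),U(k),W(k))$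 almost surely for all $k\in\mathbb N_0$; such a pair is \emph{stationary} if the laws of $X(k)$ and of $U(k)$ do not depend on $k$. Let $\mathbb F$ be the set of measurable $\pi:\mathbb R^n\to\mathbb R^l$ with $\pi\circ X\in L^2$ for every $X\in L^2(\Omega;\mathbb R^n)$. A stationary pair is \emph{in feedback form} with $(\varrho,\pi)$, $\pi\in\mathbb F$, if $X(k)\sim\varrho$ and $U(k)=\pi\circ X(k)$ almost surely for all $k$. \textbf{Assumptions.} The equation $(I-A)x^s-Bu^s=E\mu_W+z$ has a solution $(x^s,u^s)$, and $(A,Q_1^{1/2})$ is detectable. \textbf{The reference pair.} Let $P$ be the positive semidefinite solution of $$P=A^TPA+(Q_1+Q_2)-A^TPB\,[(R_1+R_2)+B^TPB]^{-1}B^TPA,$$ and let $K=-[(R_1+R_2)+B^TPB]^{-1}B^TPA$. Let $(\tilde x,\tilde u)$ minimize $x^TQ_1x+u^TR_1u+\hat s^Tx+\hat v^Tu+\hat c$ over all $(x,u)$ with $(I-A)x-Bu=0$, where $\hat s=s+2Q_1x^s$, $\hat v=v+2R_1u^s$ and $\hat c=(x^s)^TQ_1x^s+(u^s)^TR_1u^s+s^Tx^s+v^Tu^s+c$.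 Let $(X^s_\star(\cdot),U^s_\star(\cdot))$ be a stationary pair with $U^s_\star(k)=K(X^s_\star(k)-\tilde x-x^s)+\tilde u+u^s$ almost surely for all $k$. \textbf{The stationary optimization problem.} Minimize $\ell(X,\pi\circ X)$ over all pairs $(\varrho,\pi)$ of a probability measure $\varrho$ on $\mathbb R^n$ and $\pi\in\mathbb F$ for which there are independent $X\in L^2(\Omega;\mathbb R^n)$, $X\sim\varrho$, and $W\in L^2(\Omega;\mathbb R^m)$, $W\sim\varrho_W$, with $f(X,\pi\circ X,W)\sim\varrho$. \textbf{Claim.} Let $(\bar\varrho,\bar\pi)$ be any solution of the stationary optimization problem, and let $(\bar X(\cdot),\bar U(\cdot))$ be any stationary pair in feedback form with $(\bar\varrho,\bar\pi)$. Then $$\Vert\bar X(k)-X^s_\star(k)\Vert_{L^2}\to0\quad\text{as }k\to\infty,$$ and moreover there is a constant $C$ with $\sum_{k=0}^{N-1}\mathbb E\big[\Vert\bar X(k)-X^s_\star(k)\Vert^2\big]\le C$ for all $N\in\mathbb N_0$. -/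

import Mathlib

open MeasureTheory ProbabilityTheory Filter Topology
open scoped MatrixOrder

noncomputable section

namespace StochLQ

/-- `ℝⁿ` with the Euclidean norm. -/
abbrev Vec (n : ℕ) : Type := EuclideanSpace ℝ (Fin n)

/-- The matrix-vector product `M x`. -/
def app {p q : ℕ} (M : Matrix (Fin p) (Fin q) ℝ) (x : Vec q) : Vec p :=
  Matrix.toEuclideanLin M x

/-- The quadratic form `xᵀ M x`. -/
def quad {p : ℕ} (M : Matrix (Fin p) (Fin p) ℝ) (x : Vec p) : ℝ :=
  inner ℝ x (app M x)

/-- The data of a generalized discrete-time stochastic linear-quadratic problem: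
dynamics `X⁺ = A X + B U + E W + z`, and cost coefficients. -/
structure LQData (n l m : ℕ) where
  A : Matrix (Fin n) (Fin n) ℝ
  B : Matrix (Fin n) (Fin l) ℝ
  E : Matrix (Fin n) (Fin m) ℝ
  z : Vec n
  Q₁ : Matrix (Fin n) (Fin n) ℝ
  Q₂ : Matrix (Fin n) (Fin n) ℝ
  R₁ : Matrix (Fin l) (Fin l) ℝ
  R₂ : Matrix (Fin l) (Fin l) ℝ
  s : Vec n
  v : Vec l
  c : ℝ

/-- All complex eigenvalues lie in the open unit disc. -/
def IsSchur {n : ℕ} (M : Matrix (Fin n) (Fin n) ℝ) : Prop :=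
  ∀ μ ∈ spectrum ℂ (M.map (algebraMap ℝ ℂ)), ‖μ‖ < 1

/-- `(A, B)` is stabilizable. -/
def Stabilizable {n l : ℕ} (A : Matrix (Fin n) (Fin n) ℝ) (B : Matrix (Fin n) (Fin l) ℝ) : Prop :=
  ∃ F : Matrix (Fin l) (Fin n) ℝ, IsSchur (A + B * F)

/-- `(A, C)` is detectable. -/
def Detectable {n p : ℕ} (A : Matrix (Fin n) (Fin n) ℝ) (C : Matrix (Fin p) (Fin n) ℝ) : Prop :=
  ∃ L : Matrix (Fin n) (Fin p) ℝ, IsSchur (A + L * C)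

/-- `ϱ` has finite second moment. -/
def FiniteSecondMoment {n : ℕ} (ϱ : ProbabilityMeasure (Vec n)) : Prop :=
  ∫⁻ x, ‖x‖ₑ ^ 2 ∂(ϱ : Measure (Vec n)) < ⊤

/-- The mean vector of a distribution. -/
def mean {n : ℕ} (ϱ : ProbabilityMeasure (Vec n)) : Vec n :=
  ∫ x, x ∂(ϱ : Measure (Vec n))

namespace LQData

variable {n l m : ℕ} (D : LQData n l m)

/-- The dynamics `f(x, u, w) = A x + B u + E w + z`. -/
def f (x : Vec n) (u : Vec l) (w : Vec m) : Vec n :=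
  app D.A x + app D.B u + app D.E w + D.z

/-- `(A, B)` is stabilizable, `Q₁, Q₂, R₂` are symmetric positive semidefinite and `R₁` is
symmetric positive definite. -/
structure Standing : Prop where
  stabilizable : Stabilizable D.A D.B
  posSemidef_Q₁ : D.Q₁.PosSemidef
  posSemidef_Q₂ : D.Q₂.PosSemidef
  posDef_R₁ : D.R₁.PosDef
  posSemidef_R₂ : D.R₂.PosSemidef

/-- `P` is a positive semidefinite solution of the discrete-time algebraic Riccati equation. -/
def IsRiccati (P : Matrix (Fin n) (Fin n) ℝ) : Prop :=
  P.PosSemidef ∧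
    P = D.A.transpose * P * D.A + (D.Q₁ + D.Q₂) -
      D.A.transpose * P * D.B * ((D.R₁ + D.R₂) + D.B.transpose * P * D.B)⁻¹ *
        D.B.transpose * P * D.A

/-- The gain `K = -[(R₁ + R₂) + Bᵀ P B]⁻¹ Bᵀ P A`. -/
def gain (P : Matrix (Fin n) (Fin n) ℝ) : Matrix (Fin l) (Fin n) ℝ :=
  -(((D.R₁ + D.R₂) + D.B.transpose * P * D.B)⁻¹ * D.B.transpose * P * D.A)

/-- `(x, u)` solves `(I - A) x - B u = E μ_W + z`. -/
def IsSteadyState (μW : Vec m) (x : Vec n) (u : Vec l) : Prop :=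
  app (1 - D.A) x - app D.B u = app D.E μW + D.z

/-- The deterministic stage cost in the coordinates shifted by `(xs, us)`:
`xᵀ Q₁ x + uᵀ R₁ u + ŝᵀ x + v̂ᵀ u + ĉ` with `ŝ = s + 2 Q₁ xs`, `v̂ = v + 2 R₁ us` and
`ĉ = xsᵀ Q₁ xs + usᵀ R₁ us + sᵀ xs + vᵀ us + c`. -/
def shiftedDetCost (xs : Vec n) (us : Vec l) (x : Vec n) (u : Vec l) : ℝ :=
  quad D.Q₁ x + quad D.R₁ u + inner ℝ (D.s + (2 : ℝ) • app D.Q₁ xs) x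
    + inner ℝ (D.v + (2 : ℝ) • app D.R₁ us) u
    + (quad D.Q₁ xs + quad D.R₁ us + inner ℝ D.s xs + inner ℝ D.v us + D.c)

/-- `(xt, ut)` minimizes the shifted deterministic stage cost over the solutions of
`(I - A) x - B u = 0`. -/
def IsOptimalShift (xs : Vec n) (us : Vec l) (xt : Vec n) (ut : Vec l) : Prop :=
  app (1 - D.A) xt - app D.B ut = 0 ∧
    ∀ (x : Vec n) (u : Vec l), app (1 - D.A) x - app D.B u = 0 →
      D.shiftedDetCost xs us xt ut ≤ D.shiftedDetCost xs us x u

end LQData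

section Processes

variable {Ω : Type*} [MeasurableSpace Ω]

/-- The covariance matrix of a random vector. -/
def covMatrix {n : ℕ} (Pr : Measure Ω) (X : Ω → Vec n) : Matrix (Fin n) (Fin n) ℝ :=
  Matrix.of fun i j => covariance (fun ω => X ω i) (fun ω => X ω j) Pr

/-- The stochastic stage cost `ℓ(X, U)`. -/
def LQData.stageCost {n l m : ℕ} (D : LQData n l m) (Pr : Measure Ω)
    (X : Ω → Vec n) (U : Ω → Vec l) : ℝ :=
  (∫ ω, (quad D.Q₁ (X ω) + quad D.R₁ (U ω) + inner ℝ D.s (X ω) + inner ℝ D.v (U ω) + D.c) ∂Pr)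
    + (D.Q₂ * covMatrix Pr X).trace + (D.R₂ * covMatrix Pr U).trace

/-- The space of feedback laws: measurable maps `π` with `π ∘ X ∈ L²` for every `X ∈ L²`. -/
def IsFeedbackLaw {n l : ℕ} (Pr : Measure Ω) (π : Vec n → Vec l) : Prop :=
  Measurable π ∧ ∀ X : Ω → Vec n, MemLp X 2 Pr → MemLp (π ∘ X) 2 Pr

/-- `W` is an i.i.d. sequence of square-integrable random vectors with law `ϱW`. -/
structure IsNoise {m : ℕ} (Pr : Measure Ω) (ϱW : ProbabilityMeasure (Vec m))
    (W : ℕ → Ω → Vec m) : Prop where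
  memLp : ∀ k, MemLp (W k) 2 Pr
  hasLaw : ∀ k, HasLaw (W k) (ϱW : Measure (Vec m)) Pr
  indep : iIndepFun W Pr

/-- `(X, U)` is a trajectory of the stochastic system: `X k`, `U k` are square-integrable,
`W k` is independent of `(X k, U k)`, and `X (k+1) = f(X k, U k, W k)` almost surely. -/
structure IsTrajectory {n l m : ℕ} (D : LQData n l m) (Pr : Measure Ω) (W : ℕ → Ω → Vec m)
    (X : ℕ → Ω → Vec n) (U : ℕ → Ω → Vec l) : Prop where
  memLp_X : ∀ k, MemLp (X k) 2 Pr
  memLp_U : ∀ k, MemLp (U k) 2 Pr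
  indep : ∀ k, IndepFun (fun ω => (X k ω, U k ω)) (W k) Pr
  step : ∀ k, X (k + 1) =ᵐ[Pr] fun ω => D.f (X k ω) (U k ω) (W k ω)

/-- `(X, U)` is a stationary pair of state and control processes. -/
def IsStationaryPair {n l m : ℕ} (D : LQData n l m) (Pr : Measure Ω) (W : ℕ → Ω → Vec m)
    (X : ℕ → Ω → Vec n) (U : ℕ → Ω → Vec l) : Prop :=
  IsTrajectory D Pr W X U ∧
    ∃ (ϱX : ProbabilityMeasure (Vec n)) (ϱU : ProbabilityMeasure (Vec l)),
      FiniteSecondMoment ϱX ∧ FiniteSecondMoment ϱU ∧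
        ∀ k, HasLaw (X k) (ϱX : Measure (Vec n)) Pr ∧ HasLaw (U k) (ϱU : Measure (Vec l)) Pr

/-- `(X, U)` is a stationary pair in feedback form with distribution `ϱ` and feedback law `π`. -/
def IsStationaryFeedbackPair {n l m : ℕ} (D : LQData n l m) (Pr : Measure Ω)
    (W : ℕ → Ω → Vec m) (ϱ : ProbabilityMeasure (Vec n)) (π : Vec n → Vec l)
    (X : ℕ → Ω → Vec n) (U : ℕ → Ω → Vec l) : Prop :=
  IsTrajectory D Pr W X U ∧ FiniteSecondMoment ϱ ∧ IsFeedbackLaw Pr π ∧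
    ∀ k, HasLaw (X k) (ϱ : Measure (Vec n)) Pr ∧ U k =ᵐ[Pr] π ∘ X k

/-- `(X, U)` is the stationary pair generated by the affine feedback
`u = K (x - xt - xs) + ut + us`, with the gain `K` obtained from `P`. -/
def IsAffineStationaryPair {n l m : ℕ} (D : LQData n l m) (Pr : Measure Ω) (W : ℕ → Ω → Vec m)
    (P : Matrix (Fin n) (Fin n) ℝ) (xs : Vec n) (us : Vec l) (xt : Vec n) (ut : Vec l)
    (X : ℕ → Ω → Vec n) (U : ℕ → Ω → Vec l) : Prop :=
  IsStationaryPair D Pr W X U ∧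
    ∀ k, U k =ᵐ[Pr] fun ω => app (D.gain P) (X k ω - xt - xs) + ut + us

/-- Constraints of the stationary optimization problem for `(π, ϱ)`, with witnesses `X`, `W`:
`X ∼ ϱ` and `W ∼ ϱW` are independent and `f(X, π ∘ X, W) ∼ ϱ`. -/
structure IsFeasible {n l m : ℕ} (D : LQData n l m) (Pr : Measure Ω)
    (ϱW : ProbabilityMeasure (Vec m)) (ϱ : ProbabilityMeasure (Vec n)) (π : Vec n → Vec l)
    (X : Ω → Vec n) (W : Ω → Vec m) : Prop where
  feedback : IsFeedbackLaw Pr π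
  memLp_X : MemLp X 2 Pr
  memLp_W : MemLp W 2 Pr
  law_X : HasLaw X (ϱ : Measure (Vec n)) Pr
  law_W : HasLaw W (ϱW : Measure (Vec m)) Pr
  indep : IndepFun X W Pr
  law_next : HasLaw (fun ω => D.f (X ω) (π (X ω)) (W ω)) (ϱ : Measure (Vec n)) Pr

/-- `(ϱ, π)` solves the stationary optimization problem: it is feasible and its cost
`ℓ(X, π ∘ X)` is at most the cost of every feasible pair. -/
def IsStationaryOptimal {n l m : ℕ} (D : LQData n l m) (Pr : Measure Ω)
    (ϱW : ProbabilityMeasure (Vec m)) (ϱ : ProbabilityMeasure (Vec n))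
    (π : Vec n → Vec l) : Prop :=
  ∃ (X : Ω → Vec n) (W : Ω → Vec m), IsFeasible D Pr ϱW ϱ π X W ∧
    ∀ (ϱ' : ProbabilityMeasure (Vec n)) (π' : Vec n → Vec l) (X' : Ω → Vec n) (W' : Ω → Vec m),
      IsFeasible D Pr ϱW ϱ' π' X' W' →
        D.stageCost Pr X (π ∘ X) ≤ D.stageCost Pr X' (π' ∘ X')

end Processes

end StochLQ

end

/-! For a feasible pair write ξ and η for the deviations of X and U = π(X) from their means.
Completing the square along the Riccati equation, taking expectations and using that X and its
successor have the same law, the stage cost splits exactly into three terms: the deterministic cost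
of the means, a term that depends only on the noise, and E[(η - Kξ)ᵀ S (η - Kξ)] with S = R₁ + R₂ +
BᵀPB positive definite (`IsFeasible.stageCost_eq`).

The means of a feasible pair form a steady state. The affine feedback has the optimal steady state
as its means and makes the penalty vanish, so it minimizes both variable terms at once. The
minimizing steady state is unique (`isOptimalShift_unique`) and S is positive definite, so every
optimal π equals the affine feedback ϱ-almost everywhere
(`IsStationaryOptimal.ae_eq_affineFeedback`).

Both processes therefore obey the same affine recursion with the same noise realization. Their
difference satisfies Z(k+1) = (A + BK) Z(k), and detectability makes A + BK Schur
(`isSchur_closedLoop`), so E‖Z(k)‖² decays geometrically. -/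

noncomputable section

namespace StochLQ

/-! ### Quadratic forms and Schur matrices. -/

section LinearAlgebra

variable {p q r : ℕ}

lemma app_eq_mulVec (M : Matrix (Fin p) (Fin q) ℝ) (x : Vec q) :
    app M x = WithLp.toLp 2 (M.mulVec (WithLp.ofLp x)) := rfl

@[simp] lemma app_add (M : Matrix (Fin p) (Fin q) ℝ) (x y : Vec q) :
    app M (x + y) = app M x + app M y := by simp [app]

@[simp] lemma app_sub (M : Matrix (Fin p) (Fin q) ℝ) (x y : Vec q) :
    app M (x - y) = app M x - app M y := by simp [app]

@[simp] lemma app_smul (M : Matrix (Fin p) (Fin q) ℝ) (t : ℝ) (x : Vec q) :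
    app M (t • x) = t • app M x := by simp [app]

@[simp] lemma app_zero (M : Matrix (Fin p) (Fin q) ℝ) : app M 0 = 0 := by simp [app]

@[simp] lemma app_one (x : Vec p) : app 1 x = x := by simp [app]

@[simp] lemma add_app (M N : Matrix (Fin p) (Fin q) ℝ) (x : Vec q) :
    app (M + N) x = app M x + app N x := by simp [app]

@[simp] lemma sub_app (M N : Matrix (Fin p) (Fin q) ℝ) (x : Vec q) :
    app (M - N) x = app M x - app N x := by simp [app]

@[simp] lemma neg_app (M : Matrix (Fin p) (Fin q) ℝ) (x : Vec q) :
    app (-M) x = -app M x := by simp [app]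

@[simp] lemma mul_app (M : Matrix (Fin p) (Fin q) ℝ) (N : Matrix (Fin q) (Fin r) ℝ) (x : Vec r) :
    app (M * N) x = app M (app N x) := by
  simp [app_eq_mulVec]

/-- The map `x ↦ M x` as a continuous linear map. -/
def appL (M : Matrix (Fin p) (Fin q) ℝ) : Vec q →L[ℝ] Vec p :=
  LinearMap.toContinuousLinearMap (Matrix.toEuclideanLin M)

lemma continuous_app (M : Matrix (Fin p) (Fin q) ℝ) : Continuous (app M) := (appL M).continuous

lemma inner_app (M : Matrix (Fin p) (Fin q) ℝ) (x : Vec p) (y : Vec q) :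
    inner ℝ x (app M y) = inner ℝ (app M.transpose x) y := by
  simp only [app_eq_mulVec, EuclideanSpace.inner_eq_star_dotProduct, star_trivial,
    Matrix.mulVec_transpose]
  rw [dotProduct_comm, Matrix.dotProduct_mulVec, dotProduct_comm]

lemma inner_app_of_isHermitian {M : Matrix (Fin p) (Fin p) ℝ} (hM : M.IsHermitian) (x y : Vec p) :
    inner ℝ x (app M y) = inner ℝ y (app M x) := by
  rw [inner_app, real_inner_comm]
  congr 2

lemma add_quad (M N : Matrix (Fin p) (Fin p) ℝ) (x : Vec p) :
    quad (M + N) x = quad M x + quad N x := by simp [quad, inner_add_right]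

lemma quad_add {M : Matrix (Fin p) (Fin p) ℝ} (hM : M.IsHermitian) (x y : Vec p) :
    quad M (x + y) = quad M x + 2 * inner ℝ x (app M y) + quad M y := by
  simp only [quad, app_add, inner_add_left, inner_add_right, inner_app_of_isHermitian hM y x]
  ring

lemma quad_smul (M : Matrix (Fin p) (Fin p) ℝ) (t : ℝ) (x : Vec p) :
    quad M (t • x) = t ^ 2 * quad M x := by
  simp only [quad, app_smul, inner_smul_left, inner_smul_right, conj_trivial]
  ring

lemma quad_sub {M : Matrix (Fin p) (Fin p) ℝ} (hM : M.IsHermitian) (x y : Vec p) :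
    quad M (x - y) = quad M x - 2 * inner ℝ x (app M y) + quad M y := by
  simp only [quad, app_sub, inner_sub_left, inner_sub_right, inner_app_of_isHermitian hM y x]
  ring

lemma quad_conj (M : Matrix (Fin p) (Fin p) ℝ) (N : Matrix (Fin p) (Fin q) ℝ) (x : Vec q) :
    quad (N.transpose * M * N) x = quad M (app N x) := by
  simp [quad, inner_app]

lemma quad_eq_dotProduct (M : Matrix (Fin p) (Fin p) ℝ) (x : Vec p) :
    quad M x = WithLp.ofLp x ⬝ᵥ M.mulVec (WithLp.ofLp x) := by
  rw [quad, app_eq_mulVec, EuclideanSpace.inner_eq_star_dotProduct, dotProduct_comm]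
  simp

lemma quad_nonneg {M : Matrix (Fin p) (Fin p) ℝ} (hM : M.PosSemidef) (x : Vec p) :
    0 ≤ quad M x := by
  simpa [quad_eq_dotProduct] using hM.dotProduct_mulVec_nonneg (WithLp.ofLp x)

lemma eq_zero_of_quad_eq_zero {M : Matrix (Fin p) (Fin p) ℝ} (hM : M.PosDef) {x : Vec p}
    (h : quad M x = 0) : x = 0 := by
  by_contra hx
  have hx' : WithLp.ofLp x ≠ 0 := fun h0 => hx (by ext i; simpa using congrFun h0 i)
  have := hM.dotProduct_mulVec_pos hx'
  rw [star_trivial, ← quad_eq_dotProduct, h] at this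
  exact lt_irrefl _ this

/-- Since ‖M^{1/2}x‖² = xᵀMx, zero cost means zero output; this is how vanishing cost terms meet the
detectability hypothesis. -/
lemma app_sqrt_eq_zero {M : Matrix (Fin p) (Fin p) ℝ} (hM : M.PosSemidef) {x : Vec p}
    (h : quad M x = 0) : app (CFC.sqrt M) x = 0 := by
  have h1 : CFC.sqrt M * CFC.sqrt M = M := CFC.sqrt_mul_sqrt_self M hM.nonneg
  have h2 : (CFC.sqrt M).IsHermitian :=
    (Matrix.nonneg_iff_posSemidef.1 (CFC.sqrt_nonneg M)).isHermitian
  have h3 : inner ℝ (app (CFC.sqrt M) x) (app (CFC.sqrt M) x) = (0 : ℝ) := by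
    rw [inner_app_of_isHermitian h2, ← mul_app, h1]
    exact h
  exact inner_self_eq_zero.1 h3

/-- Real and imaginary parts of an eigenvector of a Schur matrix. -/
lemma IsSchur.sq_add_sq_lt_one {M : Matrix (Fin p) (Fin p) ℝ} (hM : IsSchur M) {α β : ℝ}
    {a b : Vec p} (ha : app M a = α • a - β • b) (hb : app M b = β • a + α • b)
    (hab : ¬ (a = 0 ∧ b = 0)) : α ^ 2 + β ^ 2 < 1 := by
  set v : Fin p → ℂ := fun i => ⟨a i, b i⟩ with hv
  have hv0 : v ≠ 0 := by
    intro h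
    apply hab
    constructor <;> ext i
    · simpa [hv] using congrArg Complex.re (congrFun h i)
    · simpa [hv] using congrArg Complex.im (congrFun h i)
  have hev : Matrix.toLin' (M.map (algebraMap ℝ ℂ)) v = (⟨α, β⟩ : ℂ) • v := by
    ext i
    have ha' : ∑ j, M i j * a j = α * a i - β * b i := by
      simpa [app_eq_mulVec, Matrix.mulVec, dotProduct] using congrArg (fun x : Vec p => x i) ha
    have hb' : ∑ j, M i j * b j = β * a i + α * b i := by
      simpa [app_eq_mulVec, Matrix.mulVec, dotProduct] using congrArg (fun x : Vec p => x i) hb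
    apply Complex.ext
    · simp [Matrix.mulVec, dotProduct, hv, ha']
    · simp [Matrix.mulVec, dotProduct, hv, hb']; ring
  have hspec : (⟨α, β⟩ : ℂ) ∈ spectrum ℂ (M.map (algebraMap ℝ ℂ)) := by
    rw [← Matrix.spectrum_toLin', ← Module.End.hasEigenvalue_iff_mem_spectrum]
    exact Module.End.hasEigenvalue_of_hasEigenvector
      ⟨Module.End.mem_eigenspace_iff.2 hev, hv0⟩
  have := hM _ hspec
  rw [← sq_lt_one_iff₀ (norm_nonneg _), ← Complex.normSq_eq_norm_sq, Complex.normSq_mk] at this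
  nlinarith

/-- Splitting a complex eigenvector into real and imaginary parts keeps spectral arguments over ℝ,
where the real forms `quad` apply. -/
lemma isSchur_of_forall {M : Matrix (Fin p) (Fin p) ℝ}
    (h : ∀ (α β : ℝ) (a b : Vec p), app M a = α • a - β • b → app M b = β • a + α • b →
      ¬ (a = 0 ∧ b = 0) → α ^ 2 + β ^ 2 < 1) : IsSchur M := by
  intro μ hμ
  rw [← Matrix.spectrum_toLin', ← Module.End.hasEigenvalue_iff_mem_spectrum] at hμ
  obtain ⟨v, hv, hv0⟩ := hμ.exists_hasEigenvector
  rw [Module.End.mem_eigenspace_iff] at hv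
  have key := h μ.re μ.im (WithLp.toLp 2 fun i => (v i).re) (WithLp.toLp 2 fun i => (v i).im)
    ?_ ?_ ?_
  · rw [← sq_lt_one_iff₀ (norm_nonneg _), ← Complex.normSq_eq_norm_sq, Complex.normSq_apply]
    nlinarith
  · ext i
    simpa [app_eq_mulVec, Matrix.mulVec, dotProduct] using congrArg Complex.re (congrFun hv i)
  · ext i
    have := congrArg Complex.im (congrFun hv i)
    simp [Matrix.mulVec, dotProduct] at this
    simp [app_eq_mulVec, Matrix.mulVec, dotProduct, this]
    ring
  · rintro ⟨h1, h2⟩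
    apply hv0
    ext i
    apply Complex.ext
    · simpa using congrArg (fun x : Vec p => x i) h1
    · simpa using congrArg (fun x : Vec p => x i) h2

lemma IsSchur.eq_zero_of_app_eq_self {M : Matrix (Fin p) (Fin p) ℝ} (hM : IsSchur M) {x : Vec p}
    (h : app M x = x) : x = 0 := by
  by_contra hx
  have := hM.sq_add_sq_lt_one (α := 1) (β := 0) (a := x) (b := 0) (by simp [h]) (by simp)
    (fun h => hx h.1)
  norm_num at this

-- Gelfand's formula: for r strictly between the spectral radius and 1, ‖Mᵏ‖ ≤ rᵏ for all large k,
-- and the finitely many remaining powers are absorbed into the constant.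
open scoped Matrix.Norms.L2Operator in
lemma IsSchur.exists_norm_app_pow_le {M : Matrix (Fin p) (Fin p) ℝ} (hM : IsSchur M) :
    ∃ C r : ℝ, 0 ≤ C ∧ 0 ≤ r ∧ r < 1 ∧ ∀ (k : ℕ) (x : Vec p), ‖app (M ^ k) x‖ ≤ C * r ^ k * ‖x‖ := by
  set N : Matrix (Fin p) (Fin p) ℂ := M.map (algebraMap ℝ ℂ) with hN
  have hrad : spectralRadius ℂ N < 1 := by
    rcases (spectrum ℂ N).eq_empty_or_nonempty with h | h
    · simp [spectralRadius, h]
    · exact_mod_cast spectrum.spectralRadius_lt_of_forall_lt_of_nonempty (r := 1) h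
        (fun μ hμ => by exact_mod_cast hM μ hμ)
  obtain ⟨r, hr0, hr1⟩ := ENNReal.lt_iff_exists_nnreal_btwn.1 hrad
  have hr1' : r < 1 := by exact_mod_cast hr1
  have hev := (spectrum.pow_nnnorm_pow_one_div_tendsto_nhds_spectralRadius N).eventually_lt_const hr0
  obtain ⟨k₀, hk₀⟩ := eventually_atTop.1 hev
  -- The bound k₀ + 1 excludes k = 0, for which the k-th root in Gelfand's formula is meaningless.
  have hpow : ∀ k, k₀ + 1 ≤ k → ‖N ^ k‖ ≤ (r : ℝ) ^ k := by
    intro k hk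
    have hkpos : (k : ℝ) ≠ 0 := by exact_mod_cast (by omega : k ≠ 0)
    have h1 := hk₀ k (by omega)
    have h2 := ENNReal.rpow_le_rpow h1.le (Nat.cast_nonneg (α := ℝ) k)
    rw [← ENNReal.rpow_mul, one_div, inv_mul_cancel₀ hkpos, ENNReal.rpow_one,
      ENNReal.rpow_natCast] at h2
    exact_mod_cast h2
  have hrpos : 0 < (r : ℝ) := by
    have : (0 : ENNReal) < r := lt_of_le_of_lt (zero_le) hr0
    exact_mod_cast this
  refine ⟨1 + ∑ j ∈ Finset.range (k₀ + 1), ‖N ^ j‖ / (r : ℝ) ^ j, r, by positivity, hrpos.le,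
    by exact_mod_cast hr1', fun k x => ?_⟩
  have hNk : ‖N ^ k‖ ≤ (1 + ∑ j ∈ Finset.range (k₀ + 1), ‖N ^ j‖ / (r : ℝ) ^ j) * (r : ℝ) ^ k := by
    rcases le_or_gt (k₀ + 1) k with hk | hk
    · refine (hpow k hk).trans (le_mul_of_one_le_left (by positivity) ?_)
      exact le_add_of_nonneg_right (Finset.sum_nonneg fun j _ => by positivity)
    · rw [← div_le_iff₀ (by positivity)]
      have := Finset.single_le_sum (f := fun j => ‖N ^ j‖ / (r : ℝ) ^ j)
        (fun j _ => by positivity) (Finset.mem_range.2 hk)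
      linarith
  -- The complex operator norm controls the real action because a real vector keeps its norm in ℂᵖ.
  set y : EuclideanSpace ℂ (Fin p) := WithLp.toLp 2 fun i => (x i : ℂ) with hy
  have hyx : ‖y‖ = ‖x‖ := by simp [EuclideanSpace.norm_eq, hy]
  have hMk : N ^ k = (M ^ k).map (algebraMap ℝ ℂ) := by
    rw [hN]
    exact (map_pow (RingHom.mapMatrix (m := Fin p) (algebraMap ℝ ℂ)) M k).symm
  have hout : ‖app (M ^ k) x‖ = ‖WithLp.toLp 2 ((N ^ k).mulVec (WithLp.ofLp y))‖ := by
    rw [hMk]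
    simp only [app_eq_mulVec, EuclideanSpace.norm_eq, hy, Matrix.mulVec, dotProduct,
      Matrix.map_apply, Complex.coe_algebraMap, ← Complex.ofReal_mul, ← Complex.ofReal_sum,
      Complex.norm_real]
  rw [hout, ← hyx]
  exact (Matrix.l2_opNorm_mulVec (N ^ k) y).trans
    (mul_le_mul_of_nonneg_right hNk (norm_nonneg _))

end LinearAlgebra

/-! ### Riccati equation, closed loop and optimal steady state. -/

section Riccati

namespace LQData

variable {n l m : ℕ} (D : LQData n l m)

/-- The matrix `(R₁ + R₂) + Bᵀ P B`. -/
def inputWeight (P : Matrix (Fin n) (Fin n) ℝ) : Matrix (Fin l) (Fin l) ℝ :=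
  (D.R₁ + D.R₂) + D.B.transpose * P * D.B

/-- The deterministic stage cost `xᵀ Q₁ x + uᵀ R₁ u + sᵀ x + vᵀ u + c`. -/
def detCost (x : Vec n) (u : Vec l) : ℝ :=
  quad D.Q₁ x + quad D.R₁ u + inner ℝ D.s x + inner ℝ D.v u + D.c

variable {D} {P : Matrix (Fin n) (Fin n) ℝ}

/-- The coefficients ŝ, v̂, ĉ are those of the expansion of `detCost` around (xs, us). -/
lemma Standing.shiftedDetCost_eq (hD : D.Standing) (xs x : Vec n) (us u : Vec l) :
    D.shiftedDetCost xs us x u = D.detCost (xs + x) (us + u) := by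
  simp only [shiftedDetCost, detCost, quad_add hD.posSemidef_Q₁.isHermitian,
    quad_add hD.posDef_R₁.isHermitian, inner_add_left, inner_add_right, inner_smul_left,
    inner_app_of_isHermitian hD.posSemidef_Q₁.isHermitian xs x,
    inner_app_of_isHermitian hD.posDef_R₁.isHermitian us u,
    real_inner_comm x (app D.Q₁ xs), real_inner_comm u (app D.R₁ us), conj_trivial]
  ring

lemma Standing.posDef_inputWeight (hD : D.Standing) (hP : P.PosSemidef) :
    (D.inputWeight P).PosDef := by
  refine (hD.posDef_R₁.add_posSemidef hD.posSemidef_R₂).add_posSemidef ?_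
  simpa using hP.conjTranspose_mul_mul_same D.B

lemma Standing.inputWeight_mul_gain (hD : D.Standing) (hP : P.PosSemidef) :
    D.inputWeight P * D.gain P = -(D.B.transpose * P * D.A) := by
  have hu : IsUnit (D.inputWeight P).det :=
    (Matrix.isUnit_iff_isUnit_det _).1 (hD.posDef_inputWeight hP).isUnit
  have : D.gain P = -((D.inputWeight P)⁻¹ * (D.B.transpose * P * D.A)) := by
    simp only [gain, inputWeight, Matrix.mul_assoc]
  rw [this, Matrix.mul_neg, Matrix.mul_nonsing_inv_cancel_left _ _ hu]

lemma IsRiccati.eq_add_gain (hP : D.IsRiccati P) :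
    P = D.A.transpose * P * D.A + (D.Q₁ + D.Q₂) + D.A.transpose * P * D.B * D.gain P := by
  have h := hP.2
  rw [gain, Matrix.mul_neg, ← sub_eq_add_neg]
  simpa only [Matrix.mul_assoc] using h

/-- Completion of squares along the Riccati equation. -/
lemma Standing.quad_completion (hD : D.Standing) (hP : D.IsRiccati P) (x : Vec n) (u : Vec l) :
    quad (D.Q₁ + D.Q₂) x + quad (D.R₁ + D.R₂) u + quad P (app D.A x + app D.B u)
      = quad P x + quad (D.inputWeight P) (u - app (D.gain P) x) := by
  have hS := (hD.posDef_inputWeight hP.1).isHermitian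
  have hPs := hP.1.isHermitian
  have hSK : ∀ y, app (D.inputWeight P) (app (D.gain P) y)
      = -app D.B.transpose (app P (app D.A y)) := fun y => by
    rw [← mul_app, hD.inputWeight_mul_gain hP.1]; simp
  have hPx : quad P x = quad P (app D.A x) + quad (D.Q₁ + D.Q₂) x
      + inner ℝ (app D.A x) (app P (app D.B (app (D.gain P) x))) := by
    conv_lhs => rw [hP.eq_add_gain]
    rw [add_quad, add_quad, quad_conj]
    congr 1
    simp [quad, inner_app D.A.transpose]
  have hSu : quad (D.inputWeight P) u = quad (D.R₁ + D.R₂) u + quad P (app D.B u) := by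
    rw [inputWeight, add_quad, quad_conj]
  have hc : ∀ w : Vec l, inner ℝ w (app D.B.transpose (app P (app D.A x)))
      = inner ℝ (app D.A x) (app P (app D.B w)) := fun w => by
    rw [inner_app, Matrix.transpose_transpose, inner_app_of_isHermitian hPs]
  rw [quad_sub hS, quad_add hPs, hPx, hSu, quad.eq_1 (D.inputWeight P), hSK, inner_neg_right,
    inner_neg_right, hc, hc]
  ring

/-- The choice u = Kx annihilates the completed square, leaving a Lyapunov identity for A + BK. -/
lemma Standing.quad_closedLoop (hD : D.Standing) (hP : D.IsRiccati P) (x : Vec n) :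
    quad P x = quad (D.Q₁ + D.Q₂) x + quad (D.R₁ + D.R₂) (app (D.gain P) x)
      + quad P (app (D.A + D.B * D.gain P) x) := by
  have := hD.quad_completion hP x (app (D.gain P) x)
  simp only [sub_self, quad.eq_1 (D.inputWeight P), app_zero, inner_zero_right, add_zero] at this
  simp [this]

/-- Let a + ib be an eigenvector with eigenvalue μ = α + iβ. Adding the Lyapunov identities for a
and b cancels the cross terms and gives P(a) + P(b) = (stage costs) + |μ|²(P(a) + P(b)). If |μ| ≥ 1,
all stage costs vanish, so K and Q₁^{1/2} kill a and b. -/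
lemma Standing.isSchur_closedLoop (hD : D.Standing) (hP : D.IsRiccati P)
    (hdetect : Detectable D.A (CFC.sqrt D.Q₁)) : IsSchur (D.A + D.B * D.gain P) := by
  obtain ⟨F, hF⟩ := hdetect
  refine isSchur_of_forall fun α β a b ha hb hab => ?_
  by_contra! hge
  have hPs := hP.1.isHermitian
  have hQa := quad_nonneg hD.posSemidef_Q₁ a
  have hQb := quad_nonneg hD.posSemidef_Q₁ b
  have hQ2a := quad_nonneg hD.posSemidef_Q₂ a
  have hQ2b := quad_nonneg hD.posSemidef_Q₂ b
  have hRpd := hD.posDef_R₁.add_posSemidef hD.posSemidef_R₂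
  have hRa := quad_nonneg hRpd.posSemidef (app (D.gain P) a)
  have hRb := quad_nonneg hRpd.posSemidef (app (D.gain P) b)
  have h1 := hD.quad_closedLoop hP a
  have h2 := hD.quad_closedLoop hP b
  rw [add_quad, ha, quad_sub hPs, quad_smul, quad_smul] at h1
  rw [add_quad, hb, quad_add hPs, quad_smul, quad_smul] at h2
  simp only [app_smul, inner_smul_left, inner_smul_right, conj_trivial] at h1 h2
  have hPa := quad_nonneg hP.1 a
  have hPb := quad_nonneg hP.1 b
  have hle : quad P a + quad P b ≤ (α ^ 2 + β ^ 2) * (quad P a + quad P b) :=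
    le_mul_of_one_le_left (by linarith) hge
  have hKa := eq_zero_of_quad_eq_zero hRpd
    (show quad (D.R₁ + D.R₂) (app (D.gain P) a) = 0 by linarith)
  have hKb := eq_zero_of_quad_eq_zero hRpd
    (show quad (D.R₁ + D.R₂) (app (D.gain P) b) = 0 by linarith)
  have hCa := app_sqrt_eq_zero hD.posSemidef_Q₁ (show quad D.Q₁ a = 0 by linarith)
  have hCb := app_sqrt_eq_zero hD.posSemidef_Q₁ (show quad D.Q₁ b = 0 by linarith)
  -- On a and b both A + BK and the Schur matrix A + F Q₁^{1/2} act as A, so μ is an eigenvalue of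
  -- the latter.
  have := hF.sq_add_sq_lt_one (α := α) (β := β) (a := a) (b := b)
    (by simpa [hCa, hKa] using ha) (by simpa [hCb, hKb] using hb) hab
  linarith

/-- The cost need not be strictly convex in x. Comparison with the midpoint forces the quadratic
part along the difference (dx, du) to vanish, so du = 0 and Q₁^{1/2}dx = 0; then dx is fixed by A,
and detectability gives dx = 0. -/
lemma Standing.isOptimalShift_unique (hD : D.Standing)
    (hdetect : Detectable D.A (CFC.sqrt D.Q₁)) {xs x₁ x₂ : Vec n} {us u₁ u₂ : Vec l}
    (h₁ : D.IsOptimalShift xs us x₁ u₁) (h₂ : app (1 - D.A) x₂ - app D.B u₂ = 0)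
    (hle : D.shiftedDetCost xs us x₂ u₂ ≤ D.shiftedDetCost xs us x₁ u₁) :
    x₂ = x₁ ∧ u₂ = u₁ := by
  obtain ⟨F, hF⟩ := hdetect
  have hQ := hD.posSemidef_Q₁.isHermitian
  have hR := hD.posDef_R₁.isHermitian
  set dx := x₂ - x₁ with hdx
  set du := u₂ - u₁ with hdu
  have hx : x₂ = x₁ + dx := by simp [hdx]
  have hu : u₂ = u₁ + du := by simp [hdu]
  have hd : app (1 - D.A) dx - app D.B du = 0 := by
    rw [hdx, hdu, app_sub, app_sub, sub_sub_sub_comm, h₂, h₁.1, sub_zero]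
  have hmid := h₁.2 (x₁ + (2⁻¹ : ℝ) • dx) (u₁ + (2⁻¹ : ℝ) • du) (by
    rw [app_add, app_add, app_smul, app_smul, add_sub_add_comm, ← smul_sub, hd, h₁.1]
    simp)
  rw [hx, hu] at hle
  have hQd := quad_nonneg hD.posSemidef_Q₁ dx
  have hRd := quad_nonneg hD.posDef_R₁.posSemidef du
  simp only [shiftedDetCost, quad_add hQ, quad_add hR, quad_smul, app_smul, inner_smul_right,
    inner_add_right] at hle hmid
  have hdu0 : du = 0 := eq_zero_of_quad_eq_zero hD.posDef_R₁ (by linarith)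
  have hC := app_sqrt_eq_zero hD.posSemidef_Q₁ (show quad D.Q₁ dx = 0 by linarith)
  have hA : app D.A dx = dx := by
    rw [hdu0] at hd
    simp only [sub_app, app_one, app_zero, sub_zero] at hd
    exact (sub_eq_zero.1 hd).symm
  have hdx0 : dx = 0 := hF.eq_zero_of_app_eq_self (by simp [hC, hA])
  exact ⟨by rw [hx, hdx0, add_zero], by rw [hu, hdu0, add_zero]⟩

end LQData

end Riccati

/-! ### Second moments and the cost in terms of means and deviations. -/

section Moments

variable {Ω : Type*} [MeasurableSpace Ω] {Pr : Measure Ω} {p q : ℕ}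

lemma memLp_app (M : Matrix (Fin p) (Fin q) ℝ) {X : Ω → Vec q} (hX : MemLp X 2 Pr) :
    MemLp (fun ω => app M (X ω)) 2 Pr :=
  (appL M).comp_memLp' hX

lemma integrable_inner_of_memLp {X Y : Ω → Vec p} (hX : MemLp X 2 Pr) (hY : MemLp Y 2 Pr) :
    Integrable (fun ω => inner ℝ (X ω) (Y ω)) Pr := by
  refine (hX.norm.integrable_mul hY.norm).mono' (hX.1.inner hY.1) (ae_of_all _ fun ω => ?_)
  simpa using abs_real_inner_le_norm (X ω) (Y ω)

lemma integrable_quad (M : Matrix (Fin p) (Fin p) ℝ) {X : Ω → Vec p} (hX : MemLp X 2 Pr) :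
    Integrable (fun ω => quad M (X ω)) Pr :=
  integrable_inner_of_memLp hX (memLp_app M hX)

lemma continuous_quad (M : Matrix (Fin p) (Fin p) ℝ) : Continuous (quad M) :=
  continuous_id.inner (continuous_app M)

lemma integral_app (M : Matrix (Fin p) (Fin q) ℝ) {X : Ω → Vec q} (hX : Integrable X Pr) :
    ∫ ω, app M (X ω) ∂Pr = app M (∫ ω, X ω ∂Pr) :=
  (appL M).integral_comp_comm hX

variable [IsProbabilityMeasure Pr]

lemma integral_sub_mean {X : Ω → Vec p} (hX : Integrable X Pr) :
    ∫ ω, (X ω - ∫ ω', X ω' ∂Pr) ∂Pr = 0 := by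
  rw [integral_sub hX (integrable_const _)]
  simp

lemma integral_quad_add_of_indepFun {M : Matrix (Fin p) (Fin p) ℝ} (hM : M.IsHermitian)
    {Y Z : Ω → Vec p} (hY : MemLp Y 2 Pr) (hZ : MemLp Z 2 Pr) (hYZ : IndepFun Y Z Pr)
    (hZ0 : ∫ ω, Z ω ∂Pr = 0) :
    ∫ ω, quad M (Y ω + Z ω) ∂Pr = ∫ ω, quad M (Y ω) ∂Pr + ∫ ω, quad M (Z ω) ∂Pr := by
  have hYi := hY.integrable one_le_two
  have hZi := hZ.integrable one_le_two
  have hcross : ∫ ω, inner ℝ (Y ω) (app M (Z ω)) ∂Pr = 0 := by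
    have h1 : IndepFun Y (fun ω => app M (Z ω)) Pr :=
      hYZ.comp measurable_id (continuous_app M).measurable
    have h2 := h1.integral_bilin hYi ((memLp_app M hZ).integrable one_le_two)
      (innerSL ℝ : Vec p →L[ℝ] Vec p →L[ℝ] ℝ)
    rw [integral_app M hZi, hZ0, app_zero] at h2
    rw [map_zero] at h2
    exact h2
  have hi := (integrable_inner_of_memLp hY (memLp_app M hZ)).const_mul 2
  simp only [quad_add hM]
  rw [integral_add ((integrable_quad M hY).fun_add hi) (integrable_quad M hZ),
    integral_add (integrable_quad M hY) hi, integral_const_mul, hcross]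
  ring

/-- The constant mean is independent of the centred deviation, so this is a case of the preceding
lemma. -/
lemma integral_quad_eq_mean_add {M : Matrix (Fin p) (Fin p) ℝ} (hM : M.IsHermitian)
    {X : Ω → Vec p} (hX : MemLp X 2 Pr) :
    ∫ ω, quad M (X ω) ∂Pr
      = quad M (∫ ω, X ω ∂Pr) + ∫ ω, quad M (X ω - ∫ ω', X ω' ∂Pr) ∂Pr := by
  have h := integral_quad_add_of_indepFun hM (memLp_const (∫ ω, X ω ∂Pr))
    (hX.sub (memLp_const (∫ ω, X ω ∂Pr))) (indepFun_const_left _ _)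
    (integral_sub_mean (hX.integrable one_le_two))
  simpa using h

lemma trace_mul_covMatrix (M : Matrix (Fin p) (Fin p) ℝ) {X : Ω → Vec p} (hX : MemLp X 2 Pr) :
    (M * covMatrix Pr X).trace = ∫ ω, quad M (X ω - ∫ ω', X ω' ∂Pr) ∂Pr := by
  have hXi := hX.integrable one_le_two
  have hcoord : ∀ i, MemLp (fun ω => (X ω - ∫ ω', X ω' ∂Pr) i) 2 Pr := fun i =>
    (EuclideanSpace.proj (𝕜 := ℝ) i).comp_memLp' (hX.sub (memLp_const (∫ ω', X ω' ∂Pr)))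
  have hmean : ∀ i, ∫ ω, X ω i ∂Pr = (∫ ω, X ω ∂Pr) i := fun i =>
    (EuclideanSpace.proj (𝕜 := ℝ) i).integral_comp_comm hXi
  have hint : ∀ i j, Integrable (fun ω => M i j *
      ((X ω - ∫ ω', X ω' ∂Pr) j * (X ω - ∫ ω', X ω' ∂Pr) i)) Pr := fun i j =>
    ((hcoord j).integrable_mul (hcoord i)).const_mul _
  have hquad : ∀ x : Vec p, quad M x = ∑ i, ∑ j, M i j * (x j * x i) := fun x => by
    rw [quad_eq_dotProduct]
    simp only [dotProduct, Matrix.mulVec, Finset.mul_sum]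
    exact Finset.sum_congr rfl fun i _ => Finset.sum_congr rfl fun j _ => by ring
  simp only [hquad]
  rw [integral_finsetSum _ fun i _ => integrable_finsetSum _ fun j _ => hint i j]
  simp only [Matrix.trace, Matrix.diag_apply, Matrix.mul_apply]
  refine Finset.sum_congr rfl fun i _ => ?_
  rw [integral_finsetSum _ fun j _ => hint i j]
  refine Finset.sum_congr rfl fun j _ => ?_
  rw [integral_const_mul]
  simp only [covMatrix, Matrix.of_apply, covariance, hmean, PiLp.sub_apply]

/-- The covariance terms see only deviations, whereas Q₁ and R₁ act on means and deviations alike.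
Hence the means are weighted by Q₁, R₁ and the deviations by Q₁ + Q₂, R₁ + R₂, the weights of the
Riccati equation. -/
lemma LQData.Standing.stageCost_eq {n l m : ℕ} {D : LQData n l m} (hD : D.Standing)
    {X : Ω → Vec n} {U : Ω → Vec l} (hX : MemLp X 2 Pr) (hU : MemLp U 2 Pr) :
    D.stageCost Pr X U = D.detCost (∫ ω, X ω ∂Pr) (∫ ω, U ω ∂Pr)
      + ∫ ω, (quad (D.Q₁ + D.Q₂) (X ω - ∫ ω', X ω' ∂Pr)
          + quad (D.R₁ + D.R₂) (U ω - ∫ ω', U ω' ∂Pr)) ∂Pr := by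
  have hXi := hX.integrable one_le_two
  have hUi := hU.integrable one_le_two
  have hξ : MemLp (fun ω => X ω - ∫ ω', X ω' ∂Pr) 2 Pr := hX.sub (memLp_const _)
  have hη : MemLp (fun ω => U ω - ∫ ω', U ω' ∂Pr) 2 Pr := hU.sub (memLp_const _)
  have i1 := integrable_quad D.Q₁ hX
  have i2 := integrable_quad D.R₁ hU
  have i3 : Integrable (fun ω => inner ℝ D.s (X ω)) Pr := hXi.const_inner D.s
  have i4 : Integrable (fun ω => inner ℝ D.v (U ω)) Pr := hUi.const_inner D.v
  rw [stageCost, trace_mul_covMatrix _ hX, trace_mul_covMatrix _ hU,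
    integral_add (((i1.fun_add i2).fun_add i3).fun_add i4) (integrable_const _),
    integral_add ((i1.fun_add i2).fun_add i3) i4, integral_add (i1.fun_add i2) i3, integral_add i1 i2,
    integral_inner hXi, integral_inner hUi,
    integral_quad_eq_mean_add hD.posSemidef_Q₁.isHermitian hX,
    integral_quad_eq_mean_add hD.posDef_R₁.isHermitian hU,
    integral_add (integrable_quad _ hξ) (integrable_quad _ hη)]
  simp only [add_quad]
  have a1 := integral_add (integrable_quad D.Q₁ hξ) (integrable_quad D.Q₂ hξ)
  have a2 := integral_add (integrable_quad D.R₁ hη) (integrable_quad D.R₂ hη)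
  rw [a1, a2, detCost]
  simp
  ring

end Moments

/-! ### Cost decomposition for feasible pairs. -/

section Feasible

variable {Ω : Type*} [MeasurableSpace Ω] {Pr : Measure Ω} [IsProbabilityMeasure Pr]
  {n l m : ℕ} {D : LQData n l m} {ϱW : ProbabilityMeasure (Vec m)}
  {ϱ : ProbabilityMeasure (Vec n)} {π : Vec n → Vec l} {X : Ω → Vec n} {W : Ω → Vec m}

lemma IsFeasible.integral_next (h : IsFeasible D Pr ϱW ϱ π X W) :
    ∫ ω, X ω ∂Pr = app D.A (∫ ω, X ω ∂Pr) + app D.B (∫ ω, π (X ω) ∂Pr)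
      + app D.E (mean ϱW) + D.z := by
  have hX := h.memLp_X
  have hU : MemLp (fun ω => π (X ω)) 2 Pr := h.feedback.2 X hX
  have j1 := (memLp_app D.A hX).integrable one_le_two
  have j2 := (memLp_app D.B hU).integrable one_le_two
  have j3 := (memLp_app D.E h.memLp_W).integrable one_le_two
  conv_lhs => rw [h.law_X.integral_eq, ← h.law_next.integral_eq]
  simp only [LQData.f]
  rw [integral_add ((j1.fun_add j2).fun_add j3) (integrable_const _), integral_add (j1.fun_add j2) j3,
    integral_add j1 j2, integral_app _ (hX.integrable one_le_two),
    integral_app _ (hU.integrable one_le_two), integral_app _ (h.memLp_W.integrable one_le_two),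
    h.law_W.integral_eq, mean]
  simp

/-- The means form a steady state, so their offset from (xs, us) solves the homogeneous equation and
competes in `IsOptimalShift`. -/
lemma IsFeasible.shift_mem (h : IsFeasible D Pr ϱW ϱ π X W) {xs : Vec n} {us : Vec l}
    (hs : D.IsSteadyState (mean ϱW) xs us) :
    app (1 - D.A) (∫ ω, X ω ∂Pr - xs) - app D.B (∫ ω, π (X ω) ∂Pr - us) = 0 := by
  have h1 := h.integral_next
  simp only [LQData.IsSteadyState, sub_app, app_one, app_sub] at hs ⊢
  rw [add_assoc, ← hs] at h1
  rw [← sub_eq_zero.2 h1]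
  abel

/-- The stage cost of a feasible pair splits into the deterministic cost of the means, a term that
depends only on the noise, and a penalty for deviating from the Riccati feedback. -/
lemma IsFeasible.stageCost_eq (h : IsFeasible D Pr ϱW ϱ π X W) (hD : D.Standing)
    {P : Matrix (Fin n) (Fin n) ℝ} (hP : D.IsRiccati P) :
    D.stageCost Pr X (π ∘ X) = D.detCost (∫ ω, X ω ∂Pr) (∫ ω, π (X ω) ∂Pr)
      + ∫ w, quad P (app D.E (w - mean ϱW)) ∂(ϱW : Measure (Vec m))
      + ∫ ω, quad (D.inputWeight P) (π (X ω) - ∫ ω', π (X ω') ∂Pr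
          - app (D.gain P) (X ω - ∫ ω', X ω' ∂Pr)) ∂Pr := by
  have hX := h.memLp_X
  have hU : MemLp (fun ω => π (X ω)) 2 Pr := h.feedback.2 X hX
  have hmean := h.integral_next
  have hcost := hD.stageCost_eq hX (h.feedback.2 X hX)
  simp only [Function.comp_apply] at hcost
  rw [hcost, add_assoc]
  congr 1
  have hWm : ∫ ω, W ω ∂Pr = mean ϱW := h.law_W.integral_eq
  set mx := ∫ ω, X ω ∂Pr with hmx
  set mu := ∫ ω, π (X ω) ∂Pr with hmu
  have hξ : MemLp (fun ω => X ω - mx) 2 Pr := hX.sub (memLp_const mx)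
  have hη : MemLp (fun ω => π (X ω) - mu) 2 Pr := hU.sub (memLp_const mu)
  have hω : MemLp (fun ω => W ω - mean ϱW) 2 Pr := h.memLp_W.sub (memLp_const _)
  have hdrift : MemLp (fun ω => app D.A (X ω - mx) + app D.B (π (X ω) - mu)) 2 Pr :=
    (memLp_app D.A hξ).add (memLp_app D.B hη)
  have hnoise := memLp_app D.E hω
  have hnoise0 : ∫ ω, app D.E (W ω - mean ϱW) ∂Pr = 0 := by
    rw [integral_app _ (hω.integrable one_le_two), ← hWm,
      integral_sub_mean (h.memLp_W.integrable one_le_two), app_zero]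
  -- The input is π(X), so the drift is a function of X alone and inherits independence from W.
  have hindep : IndepFun (fun ω => app D.A (X ω - mx) + app D.B (π (X ω) - mu))
      (fun ω => app D.E (W ω - mean ϱW)) Pr := by
    refine h.indep.comp (φ := fun x => app D.A (x - mx) + app D.B (π x - mu))
      (ψ := fun w => app D.E (w - mean ϱW)) ?_ ?_
    · exact ((continuous_app D.A).measurable.comp (measurable_id.sub_const mx)).add
        ((continuous_app D.B).measurable.comp (h.feedback.1.sub_const mu))
    · exact (continuous_app D.E).measurable.comp (measurable_id.sub_const _)
  have hcq : Continuous fun x : Vec n => quad P (x - mx) :=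
    (continuous_quad P).comp (continuous_id.sub continuous_const)
  -- Stationarity enters here: X and its successor give the same expected P-energy, and the centred
  -- noise contributes additively.
  have hstat : ∫ ω, quad P (X ω - mx) ∂Pr
      = ∫ ω, quad P (app D.A (X ω - mx) + app D.B (π (X ω) - mu)) ∂Pr
        + ∫ w, quad P (app D.E (w - mean ϱW)) ∂(ϱW : Measure (Vec m)) := by
    have e1 : ∫ ω, quad P (X ω - mx) ∂Pr
        = ∫ ω, quad P (D.f (X ω) (π (X ω)) (W ω) - mx) ∂Pr :=
      (h.law_X.integral_comp hcq.aestronglyMeasurable).trans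
        (h.law_next.integral_comp hcq.aestronglyMeasurable).symm
    have e2 : ∀ ω, D.f (X ω) (π (X ω)) (W ω) - mx
        = app D.A (X ω - mx) + app D.B (π (X ω) - mu) + app D.E (W ω - mean ϱW) := fun ω => by
      simp only [LQData.f, app_sub]
      rw [← sub_eq_zero, ← sub_eq_zero.2 hmean.symm]
      abel
    have hcw : Continuous fun w : Vec m => quad P (app D.E (w - mean ϱW)) :=
      (continuous_quad P).comp ((continuous_app D.E).comp (continuous_id.sub continuous_const))
    have e3 : ∫ ω, quad P (app D.E (W ω - mean ϱW)) ∂Pr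
        = ∫ w, quad P (app D.E (w - mean ϱW)) ∂(ϱW : Measure (Vec m)) :=
      h.law_W.integral_comp hcw.aestronglyMeasurable
    rw [e1]
    simp only [e2]
    rw [integral_quad_add_of_indepFun hP.1.isHermitian hdrift hnoise hindep hnoise0, e3]
  have hcomp : ∀ ω, quad (D.Q₁ + D.Q₂) (X ω - mx) + quad (D.R₁ + D.R₂) (π (X ω) - mu)
      = quad P (X ω - mx) + quad (D.inputWeight P) (π (X ω) - mu - app (D.gain P) (X ω - mx))
        - quad P (app D.A (X ω - mx) + app D.B (π (X ω) - mu)) := fun ω => by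
    rw [← hD.quad_completion hP]
    ring
  have k2 : Integrable (fun ω => quad (D.inputWeight P)
      (π (X ω) - mu - app (D.gain P) (X ω - mx))) Pr :=
    integrable_quad _ (hη.sub (memLp_app _ hξ))
  simp only [hcomp]
  rw [integral_sub ((integrable_quad P hξ).fun_add k2) (integrable_quad P hdrift),
    integral_add (integrable_quad P hξ) k2, hstat]
  ring

end Feasible

/-! ### Optimal feedback laws coincide with the affine feedback. -/

section Optimal

variable {Ω : Type*} [MeasurableSpace Ω] {Pr : Measure Ω} [IsProbabilityMeasure Pr]
  {n l m : ℕ} {D : LQData n l m} {ϱW : ProbabilityMeasure (Vec m)}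
  {W : ℕ → Ω → Vec m} {P : Matrix (Fin n) (Fin n) ℝ} {xs xt : Vec n} {us ut : Vec l}

/-- The affine feedback `x ↦ K (x - xt - xs) + ut + us`. -/
def LQData.affineFeedback (D : LQData n l m) (P : Matrix (Fin n) (Fin n) ℝ) (xs : Vec n)
    (us : Vec l) (xt : Vec n) (ut : Vec l) (x : Vec n) : Vec l :=
  app (D.gain P) (x - xt - xs) + ut + us

lemma measurable_affineFeedback : Measurable (D.affineFeedback P xs us xt ut) := by
  refine Continuous.measurable ?_
  exact (((continuous_app _).comp ((continuous_id.sub continuous_const).sub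
    continuous_const)).add continuous_const).add continuous_const

lemma isFeedbackLaw_affineFeedback : IsFeedbackLaw Pr (D.affineFeedback P xs us xt ut) :=
  ⟨measurable_affineFeedback, fun _ hX =>
    ((memLp_app _ ((hX.sub (memLp_const xt)).sub (memLp_const xs))).add
      (memLp_const ut)).add (memLp_const us)⟩

/-- The given reference pair, read at times 0 and 1, supplies the competitor, so no stationary law
has to be constructed. -/
lemma IsAffineStationaryPair.exists_isFeasible {X : ℕ → Ω → Vec n} {U : ℕ → Ω → Vec l}
    (h : IsAffineStationaryPair D Pr W P xs us xt ut X U) (hW : IsNoise Pr ϱW W) :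
    ∃ ϱ, IsFeasible D Pr ϱW ϱ (D.affineFeedback P xs us xt ut) (X 0) (W 0) := by
  obtain ⟨⟨htraj, ϱX, ϱU, -, -, hlaw⟩, hU⟩ := h
  refine ⟨ϱX, isFeedbackLaw_affineFeedback, htraj.memLp_X 0, hW.memLp 0, (hlaw 0).1,
    hW.hasLaw 0, (htraj.indep 0).comp measurable_fst measurable_id, ?_⟩
  refine (hlaw 1).1.congr ?_
  filter_upwards [htraj.step 0, hU 0] with ω h1 h2
  rw [h1, h2]
  rfl

lemma integral_affineFeedback {X : Ω → Vec n} (hX : MemLp X 2 Pr) :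
    ∫ ω, D.affineFeedback P xs us xt ut (X ω) ∂Pr
      = app (D.gain P) (∫ ω, X ω ∂Pr - xt - xs) + ut + us := by
  have h1 : MemLp (fun ω => X ω - xt - xs) 2 Pr := (hX.sub (memLp_const xt)).sub (memLp_const xs)
  have h2 := (memLp_app (D.gain P) h1).integrable one_le_two
  have hXi := hX.integrable one_le_two
  simp only [LQData.affineFeedback]
  rw [integral_add (h2.fun_add (integrable_const _)) (integrable_const _),
    integral_add h2 (integrable_const _), integral_app _ (h1.integrable one_le_two),
    integral_sub (f := fun ω => X ω - xt) (hXi.sub (integrable_const _)) (integrable_const _),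
    integral_sub hXi (integrable_const _)]
  simp

/-- A stationary state under the affine feedback has mean `xs + xt`. -/
lemma IsFeasible.integral_eq_of_affineFeedback {ϱ : ProbabilityMeasure (Vec n)} {X : Ω → Vec n}
    {W : Ω → Vec m} (h : IsFeasible D Pr ϱW ϱ (D.affineFeedback P xs us xt ut) X W)
    (hK : IsSchur (D.A + D.B * D.gain P)) (hs : D.IsSteadyState (mean ϱW) xs us)
    (ht : app (1 - D.A) xt - app D.B ut = 0) : ∫ ω, X ω ∂Pr = xs + xt := by
  have h1 := h.shift_mem hs
  rw [integral_affineFeedback h.memLp_X] at h1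
  -- The offset of the mean is a fixed point of A + BK, and a Schur matrix does not have the
  -- eigenvalue 1.
  have h2 : ∫ ω, X ω ∂Pr - xt - xs = 0 := by
    refine hK.eq_zero_of_app_eq_self ?_
    rw [← sub_eq_zero, ← neg_eq_zero, ← sub_eq_zero.2 (h1.trans ht.symm)]
    simp only [add_app, sub_app, mul_app, app_one, app_sub, app_add]
    abel
  rw [← sub_eq_zero, ← h2]
  abel

/-- Optimal stationary feedback laws agree almost surely with the affine feedback. -/
lemma IsStationaryOptimal.ae_eq_affineFeedback {ϱ : ProbabilityMeasure (Vec n)}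
    {π : Vec n → Vec l} (hopt : IsStationaryOptimal D Pr ϱW ϱ π) (hD : D.Standing)
    (hP : D.IsRiccati P) (hdetect : Detectable D.A (CFC.sqrt D.Q₁))
    (hs : D.IsSteadyState (mean ϱW) xs us) (hshift : D.IsOptimalShift xs us xt ut)
    (hW : IsNoise Pr ϱW W) {X : ℕ → Ω → Vec n} {U : ℕ → Ω → Vec l}
    (hstar : IsAffineStationaryPair D Pr W P xs us xt ut X U) :
    ∀ᵐ x ∂(ϱ : Measure (Vec n)), π x = D.affineFeedback P xs us xt ut x := by
  obtain ⟨Y, V, hfeas, hmin⟩ := hopt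
  obtain ⟨ϱ', hfeas'⟩ := hstar.exists_isFeasible hW
  have hle := hmin _ _ _ _ hfeas'
  have hmean := hfeas'.integral_eq_of_affineFeedback
    (hD.isSchur_closedLoop hP hdetect) hs hshift.1
  have hmeanU : ∫ ω, D.affineFeedback P xs us xt ut (X 0 ω) ∂Pr = us + ut := by
    rw [integral_affineFeedback hfeas'.memLp_X, hmean, add_sub_cancel_right, sub_self, app_zero,
      zero_add, add_comm]
  rw [hfeas.stageCost_eq hD hP, hfeas'.stageCost_eq hD hP, hmean, hmeanU] at hle
  -- The affine feedback incurs no penalty: its deviation is exactly K times the state deviation.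
  have hzero : ∀ x, D.affineFeedback P xs us xt ut x - (us + ut)
      - app (D.gain P) (x - (xs + xt)) = 0 := fun x => by
    simp only [LQData.affineFeedback, app_sub, app_add]
    abel
  have hS := hD.posDef_inputWeight hP.1
  simp only [hzero, quad.eq_1 _ (0 : Vec l), inner_zero_left, integral_zero] at hle
  set mx := ∫ ω, Y ω ∂Pr with hmx
  set mu := ∫ ω, π (Y ω) ∂Pr with hmu
  have hint : Integrable (fun ω => quad (D.inputWeight P)
      (π (Y ω) - mu - app (D.gain P) (Y ω - mx))) Pr := by
    have hU : MemLp (fun ω => π (Y ω)) 2 Pr := hfeas.feedback.2 Y hfeas.memLp_X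
    exact integrable_quad _ ((hU.sub (memLp_const mu)).sub
      (memLp_app _ (hfeas.memLp_X.sub (memLp_const mx))))
  have hnn : 0 ≤ ∫ ω, quad (D.inputWeight P) (π (Y ω) - mu - app (D.gain P) (Y ω - mx)) ∂Pr :=
    integral_nonneg fun ω => quad_nonneg hS.posSemidef _
  have hmem : app (1 - D.A) (mx - xs) - app D.B (mu - us) = 0 := hfeas.shift_mem hs
  have hdet := hshift.2 _ _ hmem
  -- The noise terms cancel and the penalty is nonnegative, so optimality compares the deterministic
  -- costs of the means.
  have hle' : D.shiftedDetCost xs us (mx - xs) (mu - us) ≤ D.shiftedDetCost xs us xt ut := by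
    rw [hD.shiftedDetCost_eq, hD.shiftedDetCost_eq, add_sub_cancel, add_sub_cancel]
    linarith
  obtain ⟨ex, eu⟩ := hD.isOptimalShift_unique hdetect hshift hmem hle'
  have hint0 : ∫ ω, quad (D.inputWeight P)
      (π (Y ω) - mu - app (D.gain P) (Y ω - mx)) ∂Pr = 0 := by
    rw [hD.shiftedDetCost_eq, hD.shiftedDetCost_eq, add_sub_cancel, add_sub_cancel] at hdet
    linarith
  rw [integral_eq_zero_iff_of_nonneg (fun ω => quad_nonneg hS.posSemidef _) hint] at hint0
  have hmeas : MeasurableSet {x | π x = D.affineFeedback P xs us xt ut x} :=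
    measurableSet_eq_fun hfeas.feedback.1 measurable_affineFeedback
  -- Passing from the witness Y to its law ϱ makes the identity available for every random vector
  -- with law ϱ.
  rw [← hfeas.law_X.map_eq, ae_map_iff hfeas.law_X.aemeasurable hmeas]
  filter_upwards [hint0] with ω hω
  have h0 := eq_zero_of_quad_eq_zero hS hω
  rw [← sub_eq_zero, ← h0, LQData.affineFeedback, ← ex, ← eu]
  simp only [app_sub]
  abel

end Optimal

/-! ### Mean-square decay under a Schur matrix. -/

section Convergence

variable {Ω : Type*} [MeasurableSpace Ω] {Pr : Measure Ω} {n : ℕ}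

lemma ae_eq_app_pow {M : Matrix (Fin n) (Fin n) ℝ} {Z : ℕ → Ω → Vec n}
    (h : ∀ k, Z (k + 1) =ᵐ[Pr] fun ω => app M (Z k ω)) (k : ℕ) :
    Z k =ᵐ[Pr] fun ω => app (M ^ k) (Z 0 ω) := by
  induction k with
  | zero => simp
  | succ k ih =>
    filter_upwards [h k, ih] with ω h1 h2
    rw [h1, h2, pow_succ', mul_app]

/-- Square-integrable processes driven by a Schur matrix decay geometrically in mean square. -/
lemma IsSchur.exists_integral_norm_sq_le {M : Matrix (Fin n) (Fin n) ℝ} (hM : IsSchur M)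
    {Z : ℕ → Ω → Vec n} (hZ : MemLp (Z 0) 2 Pr)
    (h : ∀ k, Z (k + 1) =ᵐ[Pr] fun ω => app M (Z k ω)) :
    ∃ C ρ : ℝ, 0 ≤ C ∧ 0 ≤ ρ ∧ ρ < 1 ∧ ∀ k, ∫ ω, ‖Z k ω‖ ^ 2 ∂Pr ≤ C * ρ ^ k := by
  obtain ⟨C, r, hC, hr0, hr1, hb⟩ := hM.exists_norm_app_pow_le
  have hint : Integrable (fun ω => ‖Z 0 ω‖ ^ 2) Pr := hZ.norm.integrable_sq
  refine ⟨C ^ 2 * ∫ ω, ‖Z 0 ω‖ ^ 2 ∂Pr, r ^ 2,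
    mul_nonneg (sq_nonneg _) (integral_nonneg fun _ => sq_nonneg _), sq_nonneg _,
    by nlinarith, fun k => ?_⟩
  have hle : ∫ ω, ‖Z k ω‖ ^ 2 ∂Pr ≤ ∫ ω, (C * r ^ k) ^ 2 * ‖Z 0 ω‖ ^ 2 ∂Pr := by
    refine integral_mono_of_nonneg (ae_of_all _ fun _ => sq_nonneg _) (hint.const_mul _) ?_
    filter_upwards [ae_eq_app_pow h k] with ω hω
    rw [hω, ← mul_pow]
    exact pow_le_pow_left₀ (norm_nonneg _) (hb k _) 2
  rw [integral_const_mul] at hle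
  refine hle.trans (le_of_eq ?_)
  ring

lemma tendsto_eLpNorm_of_integral_norm_sq {Z : ℕ → Ω → Vec n} (hZ : ∀ k, MemLp (Z k) 2 Pr)
    (h : Tendsto (fun k => ∫ ω, ‖Z k ω‖ ^ 2 ∂Pr) atTop (𝓝 0)) :
    Tendsto (fun k => eLpNorm (Z k) 2 Pr) atTop (𝓝 0) := by
  have heq : ∀ k, eLpNorm (Z k) 2 Pr = ENNReal.ofReal ((∫ ω, ‖Z k ω‖ ^ 2 ∂Pr) ^ (2⁻¹ : ℝ)) :=
    fun k => by
      rw [(hZ k).eLpNorm_eq_integral_rpow_norm (by norm_num) (by norm_num)]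
      simp
  simp only [heq]
  have h1 := (h.rpow_const (p := (2⁻¹ : ℝ)) (Or.inr (by norm_num)))
  rw [Real.zero_rpow (by norm_num)] at h1
  simpa using ENNReal.tendsto_ofReal h1

end Convergence

end StochLQ

end

theorem mainTheorem7 {n l m : ℕ} {Ω : Type*} [MeasurableSpace Ω]
    (Pr : Measure Ω) [IsProbabilityMeasure Pr]
    (D : StochLQ.LQData n l m) (hD : D.Standing)
    (ϱW : ProbabilityMeasure (StochLQ.Vec m)) (W : ℕ → Ω → StochLQ.Vec m)
    (hW : StochLQ.IsNoise Pr ϱW W)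
    (xs : StochLQ.Vec n) (us : StochLQ.Vec l)
    (hsteady : D.IsSteadyState (StochLQ.mean ϱW) xs us)
    (hdetect : StochLQ.Detectable D.A (CFC.sqrt D.Q₁))
    (P : Matrix (Fin n) (Fin n) ℝ) (hP : D.IsRiccati P)
    (xt : StochLQ.Vec n) (ut : StochLQ.Vec l) (hshift : D.IsOptimalShift xs us xt ut)
    (Xstar : ℕ → Ω → StochLQ.Vec n) (Ustar : ℕ → Ω → StochLQ.Vec l)
    (hstar : StochLQ.IsAffineStationaryPair D Pr W P xs us xt ut Xstar Ustar)
    (ϱbar : ProbabilityMeasure (StochLQ.Vec n)) (πbar : StochLQ.Vec n → StochLQ.Vec l)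
    (hopt : StochLQ.IsStationaryOptimal D Pr ϱW ϱbar πbar)
    (Xbar : ℕ → Ω → StochLQ.Vec n) (Ubar : ℕ → Ω → StochLQ.Vec l)
    (hbar : StochLQ.IsStationaryFeedbackPair D Pr W ϱbar πbar Xbar Ubar) :
    Tendsto (fun k => eLpNorm (Xbar k - Xstar k) 2 Pr) atTop (𝓝 0) ∧
      ∃ C : ℝ, ∀ N : ℕ,
        (∑ k ∈ Finset.range N, ∫ ω, ‖Xbar k ω - Xstar k ω‖ ^ 2 ∂Pr) ≤ C := by
  have hπ := hopt.ae_eq_affineFeedback hD hP hdetect hsteady hshift hW hstar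
  obtain ⟨⟨htstar, -⟩, hUstar⟩ := hstar
  obtain ⟨htbar, -, -, hlaw⟩ := hbar
  have hZ : ∀ k, MemLp (Xbar k - Xstar k) 2 Pr := fun k =>
    (htbar.memLp_X k).sub (htstar.memLp_X k)
  -- Both processes are driven by the same W(k), so the noise and all constant terms cancel in the
  -- difference.
  have hstep : ∀ k, Xbar (k + 1) - Xstar (k + 1) =ᵐ[Pr]
      fun ω => StochLQ.app (D.A + D.B * D.gain P) ((Xbar k - Xstar k) ω) := fun k => by
    have hfb : ∀ᵐ ω ∂Pr, πbar (Xbar k ω) = D.affineFeedback P xs us xt ut (Xbar k ω) := by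
      rw [← (hlaw k).1.map_eq] at hπ
      exact ae_of_ae_map (hlaw k).1.aemeasurable hπ
    filter_upwards [htbar.step k, htstar.step k, hUstar k, (hlaw k).2, hfb]
      with ω h1 h2 h3 h4 h5
    rw [Pi.sub_apply, h1, h2, h3, h4, Function.comp_apply, h5]
    simp only [StochLQ.LQData.f, StochLQ.LQData.affineFeedback, StochLQ.add_app,
      StochLQ.mul_app, StochLQ.app_sub, StochLQ.app_add, Pi.sub_apply]
    abel
  obtain ⟨C, ρ, hC, hρ0, hρ1, hbound⟩ :=
    (hD.isSchur_closedLoop hP hdetect).exists_integral_norm_sq_le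
      (Z := fun k => Xbar k - Xstar k) (hZ 0) hstep
  -- The constant is the sum of the full geometric series C ρᵏ.
  refine ⟨StochLQ.tendsto_eLpNorm_of_integral_norm_sq hZ ?_, C * (1 - ρ)⁻¹, fun N => ?_⟩
  · refine squeeze_zero (fun k => integral_nonneg fun _ => sq_nonneg _) hbound ?_
    simpa using (tendsto_pow_atTop_nhds_zero_of_lt_one hρ0 hρ1).const_mul C
  · calc (∑ k ∈ Finset.range N, ∫ ω, ‖Xbar k ω - Xstar k ω‖ ^ 2 ∂Pr)
        ≤ ∑ k ∈ Finset.range N, C * ρ ^ k := Finset.sum_le_sum fun k _ => hbound k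
      _ = C * ∑ k ∈ Finset.range N, ρ ^ k := by rw [Finset.mul_sum]
      _ ≤ C * (1 - ρ)⁻¹ := by
        refine mul_le_mul_of_nonneg_left ?_ hC
        rw [← tsum_geometric_of_lt_one hρ0 hρ1]
        exact (summable_geometric_of_lt_one hρ0 hρ1).sum_le_tsum _
          fun k _ => pow_nonneg hρ0 k
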